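/- Let $N,m$ be non-negative integers, let $H\in\mathbb{C}^{N\times N}$ be a Hermitian negative definite matrix, and define the OMM (orbital minimization method) functional $E_0$ on $\mathbb{C}^{N\times m}$ by $$E_0(X)=\operatorname{tr}\bigl[(2I-X^*X)X^*HX\bigr],$$ which is real-valued because $H$ is Hermitian. Then every local minimum of $E_0$ on $\mathbb{C}^{N\times m}$ is a global minimum. Moreover, if $m\le N$, then $X\in\mathbb{C}^{N\times m}$ is a global minimum of $E_0$ if and only if $X^*X=I$ and the column space of $X$ is spanned by eigenvectors corresponding to the $m$ most negative eigenvalues of $H$ counted with multiplicity; that is, if and only if the columns of $X$ are orthonormal and there exist an orthonormal basis $y_1,\dots,y_N$ of $\mathbb{C}^N$ and real numbers $\lambda_1\le\dots\le\lambda_N$ with $Hy_i=\lambda_iy_i$ for all $i$ such that the columns of $X$ span $\operatorname{span}\{y_1,\dots,y_m\}$. (If $\lambda_m=\lambda_{m+1}$ this subspace is not unique, and every such choice is allowed.) -/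

import Mathlib

open scoped Matrix ComplexOrder

/-- The complex number `tr[(2I - X*X) X*HX]`. -/
def ommTrace {N m : ℕ} (H : Matrix (Fin N) (Fin N) ℂ) (X : Matrix (Fin N) (Fin m) ℂ) : ℂ :=
  (((2 : ℂ) • (1 : Matrix (Fin m) (Fin m) ℂ) - Xᴴ * X) * (Xᴴ * H * X)).trace

/-- The OMM functional `E₀(X) = tr[(2I - X*X) X*HX]` on `ℂ^{N×m}`, as a real number.
For Hermitian `H` the trace is real, see `ommE_eq_trace`. -/
def ommE {N m : ℕ} (H : Matrix (Fin N) (Fin N) ℂ) (X : Matrix (Fin N) (Fin m) ℂ) : ℝ :=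
  (ommTrace H X).re

/-- For Hermitian `H`, taking the real part in `ommE` loses nothing. -/
theorem ommE_eq_trace {N m : ℕ} {H : Matrix (Fin N) (Fin N) ℂ} (hH : H.IsHermitian)
    (X : Matrix (Fin N) (Fin m) ℂ) : (ommE H X : ℂ) = ommTrace H X := by
  refine Complex.conj_eq_iff_re.mp ?_
  change star (ommTrace H X) = ommTrace H X
  unfold ommTrace
  rw [← Matrix.trace_conjTranspose, Matrix.conjTranspose_mul, Matrix.trace_mul_comm]
  congr 2
  · simp [Matrix.conjTranspose_smul]
  · simp [Matrix.conjTranspose_mul, hH.eq, Matrix.mul_assoc]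

/-- `V` is spanned by eigenvectors corresponding to the `m` lowest eigenvalues of `H`, counted
with multiplicity: there are a complete orthonormal set of eigenvectors `b 0, b 1, …` of `H`, with
eigenvalues `ev 0 ≤ ev 1 ≤ …`, such that `V` is the span of the first `m` of them.
If the `m`-th and `(m+1)`-st eigenvalues coincide, any choice of eigenvectors is allowed. -/
def IsLowLyingEigenspace {N : ℕ} (H : Matrix (Fin N) (Fin N) ℂ) (m : ℕ)
    (V : Submodule ℂ (Fin N → ℂ)) : Prop :=
  ∃ (b : OrthonormalBasis (Fin N) ℂ (EuclideanSpace ℂ (Fin N))) (ev : Fin N → ℝ),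
    Monotone ev ∧
    (∀ i, H *ᵥ (b i).ofLp = (ev i : ℂ) • (b i).ofLp) ∧
    V = Submodule.span ℂ ((fun i => (b i).ofLp) '' {i : Fin N | (i : ℕ) < m})

open Filter Topology

/-! Write `H = -A` with `A` positive definite and `P = X * Xᴴ`. Cyclicity of the trace gives `E₀(X)
= tr[(P² - 2P)A]`, so variations of `X` can be read off from `P`.

At a local minimum the gradient equation forces `X` to be a partial isometry
(`ommE_localMin_partialIsometry`), and a second variation from `ker X` into `ker Xᴴ` makes one of
these kernels trivial (`ommE_localMin_fullRank`). Hence `Xᴴ * X = 1` or `X * Xᴴ = 1`.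

If `X * Xᴴ = 1`, completing the square shows that `X` is a global minimum. If `Xᴴ * X = 1`, then `P`
is a projection commuting with `A`, and another second variation puts the top of the spectrum of `A`
on its range (`isLowLyingEigenspace_of_localMin`). Such `X` attain the lower bound
`le_ommE_of_eigenbasis`, obtained by diagonalizing `A` and using the bathtub principle. -/

/-! ### The functional along lines -/

theorem ommE_neg_eq {N m : ℕ} (A : Matrix (Fin N) (Fin N) ℂ) (X : Matrix (Fin N) (Fin m) ℂ) :
    ommE (-A) X = (((X * Xᴴ) * (X * Xᴴ) - (2 : ℂ) • (X * Xᴴ)) * A).trace.re := by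
  have h1 : (Xᴴ * A * X).trace = (X * Xᴴ * A).trace := by
    rw [Matrix.mul_assoc, Matrix.trace_mul_comm, Matrix.mul_assoc, Matrix.trace_mul_comm]
  have h2 : (Xᴴ * X * (Xᴴ * A * X)).trace = (X * Xᴴ * (X * Xᴴ) * A).trace := by
    have : Xᴴ * X * (Xᴴ * A * X) = Xᴴ * (X * Xᴴ * A * X) := by simp only [Matrix.mul_assoc]
    rw [this, Matrix.trace_mul_comm, ← Matrix.mul_assoc,
      show X * Xᴴ * A * X * Xᴴ = (X * Xᴴ * A) * (X * Xᴴ) by simp only [Matrix.mul_assoc],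
      Matrix.trace_mul_comm, Matrix.mul_assoc (X * Xᴴ)]
    simp only [Matrix.mul_assoc]
  unfold ommE ommTrace
  congr 1
  simp only [sub_mul, Matrix.mul_neg, Matrix.neg_mul, Matrix.trace_sub, Matrix.trace_neg,
    Matrix.smul_mul, Matrix.trace_smul, Matrix.one_mul, h1, h2]
  simp only [smul_eq_mul]
  ring

theorem trace_quadratic_expansion {N : ℕ} (A P B C : Matrix (Fin N) (Fin N) ℂ) (t : ℝ) :
    (((P + (t : ℂ) • B + ((t : ℂ) ^ 2) • C) * (P + (t : ℂ) • B + ((t : ℂ) ^ 2) • C)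
      - (2 : ℂ) • (P + (t : ℂ) • B + ((t : ℂ) ^ 2) • C)) * A).trace.re =
    ((P * P - (2 : ℂ) • P) * A).trace.re + (t * ((P * B + B * P - (2 : ℂ) • B) * A).trace.re
      + t ^ 2 * ((B * B + (P * C + C * P - (2 : ℂ) • C)) * A).trace.re
      + t ^ 3 * ((B * C + C * B) * A).trace.re + t ^ 4 * (C * C * A).trace.re) := by
  simp only [add_mul, mul_add, sub_mul, Matrix.smul_mul, Matrix.mul_smul, Matrix.trace_add,
    Matrix.trace_sub, Matrix.trace_smul, smul_smul, smul_add, smul_eq_mul]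
  simp only [Complex.add_re, Complex.sub_re, ← Complex.ofReal_pow, ← Complex.ofReal_mul,
    ← Complex.ofReal_ofNat, Complex.re_ofReal_mul]
  ring

theorem nonneg_of_eventually_pos_mul {g : ℝ → ℝ} (hg : Continuous g) {k : ℕ}
    (h : ∀ᶠ t in 𝓝[>] (0 : ℝ), 0 ≤ t ^ k * g t) : 0 ≤ g 0 := by
  refine ge_of_tendsto (hg.continuousAt.tendsto.mono_left (nhdsWithin_le_nhds (s := Set.Ioi 0))) ?_
  filter_upwards [h, self_mem_nhdsWithin] with t ht h0
  exact nonneg_of_mul_nonneg_right ht (pow_pos h0 k)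

/-- The lowest-order term decides the sign near 0; using both `t` and `-t` kills the linear
coefficient. -/
theorem quartic_coeffs_of_eventually_nonneg {c₁ c₂ c₃ c₄ : ℝ}
    (h : ∀ᶠ t in 𝓝 (0 : ℝ), 0 ≤ t * c₁ + t ^ 2 * c₂ + t ^ 3 * c₃ + t ^ 4 * c₄) :
    c₁ = 0 ∧ 0 ≤ c₂ := by
  have hneg : ∀ᶠ t in 𝓝 (0 : ℝ), 0 ≤ (-t) * c₁ + (-t) ^ 2 * c₂ + (-t) ^ 3 * c₃ + (-t) ^ 4 * c₄ := by
    have : Tendsto (fun t : ℝ => -t) (𝓝 0) (𝓝 0) := by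
      simpa using (continuous_neg (G := ℝ)).tendsto 0
    exact this.eventually h
  have h1 : 0 ≤ c₁ := by
    have := nonneg_of_eventually_pos_mul (k := 1)
      (g := fun t => c₁ + t * c₂ + t ^ 2 * c₃ + t ^ 3 * c₄) (by fun_prop)
      ((h.filter_mono nhdsWithin_le_nhds).mono fun t ht => by linarith)
    simpa using this
  have h2 : 0 ≤ -c₁ := by
    have := nonneg_of_eventually_pos_mul (k := 1)
      (g := fun t => -c₁ + t * c₂ - t ^ 2 * c₃ + t ^ 3 * c₄) (by fun_prop)
      ((hneg.filter_mono nhdsWithin_le_nhds).mono fun t ht => by linarith)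
    simpa using this
  have h3 : c₁ = 0 := by linarith
  refine ⟨h3, ?_⟩
  have := nonneg_of_eventually_pos_mul (k := 2)
      (g := fun t => c₂ + t * c₃ + t ^ 2 * c₄) (by fun_prop)
      ((h.filter_mono nhdsWithin_le_nhds).mono fun t ht => by rw [h3] at ht; linarith)
  simpa using this

/-- First- and second-order necessary conditions at a local minimum, in terms of `X * Xᴴ`. -/
theorem ommE_localMin_conditions {N m : ℕ} {A : Matrix (Fin N) (Fin N) ℂ}
    {X : Matrix (Fin N) (Fin m) ℂ} (hX : IsLocalMin (ommE (-A)) X)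
    (D : Matrix (Fin N) (Fin m) ℂ) {P B C : Matrix (Fin N) (Fin N) ℂ} (hP : P = X * Xᴴ)
    (hB : B = X * Dᴴ + D * Xᴴ) (hC : C = D * Dᴴ) :
    ((P * B + B * P - (2 : ℂ) • B) * A).trace.re = 0 ∧
      0 ≤ ((B * B + (P * C + C * P - (2 : ℂ) • C)) * A).trace.re := by
  apply quartic_coeffs_of_eventually_nonneg (c₃ := ((B * C + C * B) * A).trace.re)
    (c₄ := (C * C * A).trace.re)
  have hlim : Tendsto (fun t : ℝ => X + (t : ℂ) • D) (𝓝 0) (𝓝 X) := by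
    have : Continuous (fun t : ℝ => X + (t : ℂ) • D) := by fun_prop
    simpa using this.tendsto 0
  filter_upwards [hlim.eventually hX] with t ht
  have hexp : (X + (t : ℂ) • D) * (X + (t : ℂ) • D)ᴴ = P + (t : ℂ) • B + ((t : ℂ) ^ 2) • C := by
    rw [hP, hB, hC]
    simp only [Matrix.conjTranspose_add, Matrix.conjTranspose_smul, Matrix.add_mul, Matrix.mul_add,
      Matrix.smul_mul, Matrix.mul_smul, smul_smul, smul_add, RCLike.star_def, Complex.conj_ofReal,
      pow_two]
    abel
  rw [ommE_neg_eq, ommE_neg_eq, hexp, trace_quadratic_expansion, ← hP] at ht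
  linarith

/-! ### Necessary conditions at a local minimum -/

theorem eq_zero_of_trace_conjTranspose_mul_mul_self {N m : ℕ} {A : Matrix (Fin N) (Fin N) ℂ}
    (hA : A.PosDef) {Z : Matrix (Fin N) (Fin m) ℂ} (h : (Zᴴ * A * Z).trace.re = 0) : Z = 0 := by
  have hps := hA.posSemidef.conjTranspose_mul_mul_same Z
  have h0 : Zᴴ * A * Z = 0 := by
    rw [← hps.trace_eq_zero_iff]
    exact Complex.ext h (Complex.nonneg_iff.mp hps.trace_nonneg).2.symm
  ext i j
  by_contra hne
  have hz : Z *ᵥ Pi.single j 1 ≠ 0 := fun h' => hne (by simpa using congrFun h' i)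
  have := hA.dotProduct_mulVec_pos hz
  rw [Matrix.star_mulVec, Matrix.dotProduct_mulVec, Matrix.vecMul_vecMul, Matrix.dotProduct_mulVec,
    Matrix.vecMul_vecMul, h0] at this
  simp at this

/-- Critical points of the functional: the gradient vanishes. -/
theorem ommE_localMin_gradient {N m : ℕ} {A : Matrix (Fin N) (Fin N) ℂ} (hA : A.IsHermitian)
    {X : Matrix (Fin N) (Fin m) ℂ} (hX : IsLocalMin (ommE (-A)) X) :
    (A * (X * Xᴴ - 1) + (X * Xᴴ - 1) * A) * X = 0 := by
  set P := X * Xᴴ with hP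
  set G := A * (P - 1) + (P - 1) * A with hG
  have hPh : Pᴴ = P := by simp [hP]
  have hGh : Gᴴ = G := by
    simp [hG, Matrix.conjTranspose_mul, hPh, hA.eq, add_comm]
  -- Vary along the gradient direction itself: the derivative is then twice the squared Frobenius
  -- norm of `G * X`.
  obtain ⟨h, -⟩ := ommE_localMin_conditions hX (G * X) hP rfl rfl
  set B := X * (G * X)ᴴ + (G * X) * Xᴴ with hB
  have h1 : ((P * B + B * P - (2 : ℂ) • B) * A).trace = (B * G).trace := by
    have e1 : (P * (B * A)).trace = (B * (A * P)).trace := by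
      rw [ Matrix.trace_mul_comm, Matrix.mul_assoc]
    rw [hG]
    simp only [add_mul, sub_mul, mul_add, mul_sub, Matrix.trace_add, Matrix.trace_sub,
      Matrix.mul_one, Matrix.one_mul, Matrix.smul_mul, Matrix.trace_smul, smul_eq_mul,
      Matrix.mul_assoc, e1]
    ring
  have h2 : (B * G).trace = 2 * ((G * X)ᴴ * (G * X)).trace := by
    rw [hB, add_mul, Matrix.trace_add, two_mul]
    congr 1
    · rw [Matrix.mul_assoc, Matrix.trace_mul_comm, Matrix.mul_assoc]
    · rw [Matrix.mul_assoc, Matrix.trace_mul_comm, Matrix.conjTranspose_mul, hGh]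
  rw [h1, h2] at h
  have hps := Matrix.posSemidef_conjTranspose_mul_self (G * X)
  rw [← Matrix.trace_conjTranspose_mul_self_eq_zero_iff]
  refine Complex.ext ?_ (Complex.nonneg_iff.mp hps.trace_nonneg).2.symm
  rw [← Complex.ofReal_ofNat, Complex.re_ofReal_mul] at h
  simpa using h

/-- A local minimizer is a partial isometry. -/
theorem ommE_localMin_partialIsometry {N m : ℕ} {A : Matrix (Fin N) (Fin N) ℂ} (hA : A.PosDef)
    {X : Matrix (Fin N) (Fin m) ℂ} (hX : IsLocalMin (ommE (-A)) X) :
    X * (Xᴴ * X - 1) = 0 := by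
  have hg := ommE_localMin_gradient hA.isHermitian hX
  set R := Xᴴ * X - 1 with hR
  have hRh : Rᴴ = R := by simp [hR]
  set T := Xᴴ * A * X with hT
  have hRT : T * R + R * T = 0 := by
    have : T * R + R * T = Xᴴ * ((A * (X * Xᴴ - 1) + (X * Xᴴ - 1) * A) * X) := by
      simp only [hT, hR, Matrix.mul_add, Matrix.add_mul, Matrix.mul_sub, Matrix.sub_mul,
        Matrix.mul_assoc, Matrix.mul_one, Matrix.one_mul]
    rw [this, hg, Matrix.mul_zero]
  -- `(X R)ᴴ A (X R) = R T R`, and `2 tr(R T R) = tr((T R + R T) R) = 0`.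
  apply eq_zero_of_trace_conjTranspose_mul_mul_self hA
  have e : (X * R)ᴴ * A * (X * R) = R * T * R := by
    rw [Matrix.conjTranspose_mul, hRh, hT]; simp only [Matrix.mul_assoc]
  have e2 : (R * T * R).trace = (T * R * R).trace := by
    rw [Matrix.trace_mul_comm, ← Matrix.mul_assoc, Matrix.trace_mul_comm, ← Matrix.mul_assoc]
  have e3 : (R * T * R).trace + (T * R * R).trace = 0 := by
    rw [add_comm, ← Matrix.trace_add, ← Matrix.add_mul, hRT]; simp
  rw [e]
  rw [← e2] at e3
  have := congrArg Complex.re e3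
  simp only [Complex.add_re, Complex.zero_re] at this
  linarith

/-- A local minimizer has full rank. -/
theorem ommE_localMin_fullRank {N m : ℕ} {A : Matrix (Fin N) (Fin N) ℂ} (hA : A.PosDef)
    {X : Matrix (Fin N) (Fin m) ℂ} (hX : IsLocalMin (ommE (-A)) X)
    {u : Fin m → ℂ} {v : Fin N → ℂ} (hu : X *ᵥ u = 0) (hv : Xᴴ *ᵥ v = 0) : u = 0 ∨ v = 0 := by
  by_contra! hne
  have hD : X * (Matrix.vecMulVec v (star u))ᴴ = 0 := by
    rw [Matrix.conjTranspose_vecMulVec, star_star, Matrix.mul_vecMulVec, hu, Matrix.zero_vecMulVec]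
  have hD' : Xᴴ * Matrix.vecMulVec v (star u) = 0 := by
    rw [Matrix.mul_vecMulVec, hv, Matrix.zero_vecMulVec]
  -- Along `v uᴴ` every term involving `X` vanishes, so the second-order coefficient is `-2 tr(Dᴴ A
  -- D)`, negative unless `D = 0`.
  obtain ⟨-, h⟩ := ommE_localMin_conditions hX (Matrix.vecMulVec v (star u)) rfl rfl rfl
  set D := Matrix.vecMulVec v (star u) with hDd
  have hD2 : D * Xᴴ = 0 := by
    have := congrArg Matrix.conjTranspose hD
    simpa [Matrix.conjTranspose_mul] using this
  have hD3 : Dᴴ * X = 0 := by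
    have := congrArg Matrix.conjTranspose hD'
    simpa [Matrix.conjTranspose_mul] using this
  have e1 : X * Xᴴ * (D * Dᴴ) = 0 := by
    rw [Matrix.mul_assoc, ← Matrix.mul_assoc Xᴴ, hD']; simp
  have e2 : D * Dᴴ * (X * Xᴴ) = 0 := by
    rw [Matrix.mul_assoc, ← Matrix.mul_assoc Dᴴ, hD3]; simp
  rw [hD, hD2, e1, e2] at h
  have e3 : (D * Dᴴ * A).trace = (Dᴴ * A * D).trace := by
    rw [Matrix.mul_assoc, Matrix.trace_mul_comm]
  have hpos : 0 ≤ (Dᴴ * A * D).trace.re :=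
    (Complex.nonneg_iff.mp (hA.posSemidef.conjTranspose_mul_mul_same D).trace_nonneg).1
  simp only [add_zero, zero_add, Matrix.mul_zero, zero_sub, Matrix.neg_mul, Matrix.trace_neg,
    Matrix.smul_mul, Matrix.trace_smul, smul_eq_mul, e3, Complex.neg_re,
    ← Complex.ofReal_ofNat, Complex.re_ofReal_mul] at h
  have hz := eq_zero_of_trace_conjTranspose_mul_mul_self hA (Z := D) (by linarith)
  obtain ⟨i, hi⟩ := Function.ne_iff.mp hne.1
  obtain ⟨j, hj⟩ := Function.ne_iff.mp hne.2
  have := congrFun (congrFun hz j) i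
  simp only [hDd, Matrix.vecMulVec_apply, Pi.star_apply, Matrix.zero_apply, mul_eq_zero,
    star_eq_zero] at this
  exact this.elim hj hi

/-! ### The global lower bound and its attainment -/

theorem OrthonormalBasis.star_dotProduct {N : ℕ}
    (b : OrthonormalBasis (Fin N) ℂ (EuclideanSpace ℂ (Fin N))) (i j : Fin N) :
    star (b i).ofLp ⬝ᵥ (b j).ofLp = if i = j then 1 else 0 := by
  rw [dotProduct_comm, ← EuclideanSpace.inner_eq_star_dotProduct]
  exact orthonormal_iff_ite.mp b.orthonormal i j

theorem OrthonormalBasis.matrix_trace_eq_sum {N : ℕ}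
    (b : OrthonormalBasis (Fin N) ℂ (EuclideanSpace ℂ (Fin N))) (M : Matrix (Fin N) (Fin N) ℂ) :
    M.trace = ∑ i, star (b i).ofLp ⬝ᵥ (M *ᵥ (b i).ofLp) := by
  set U : Matrix (Fin N) (Fin N) ℂ := Matrix.of fun i j => (b j).ofLp i with hU
  have hent : ∀ (L : Matrix (Fin N) (Fin N) ℂ) i j,
      (Uᴴ * (L * U)) i j = star (b i).ofLp ⬝ᵥ (L *ᵥ (b j).ofLp) := by
    intro L i j
    simp [Matrix.mul_apply, hU, dotProduct, Matrix.mulVec]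
  have h1 : Uᴴ * U = 1 := by
    ext i j
    have := hent 1 i j
    rw [Matrix.one_mul, Matrix.one_mulVec, b.star_dotProduct] at this
    rw [this, Matrix.one_apply]
  have h2 : U * Uᴴ = 1 := mul_eq_one_comm.mp h1
  calc M.trace = (Uᴴ * (M * U)).trace := by
        rw [Matrix.trace_mul_comm, Matrix.mul_assoc, h2, Matrix.mul_one]
    _ = _ := by simp only [Matrix.trace, Matrix.diag_apply, hent]

theorem OrthonormalBasis.eq_sum_star_dotProduct_smul {N : ℕ}
    (b : OrthonormalBasis (Fin N) ℂ (EuclideanSpace ℂ (Fin N))) (x : Fin N → ℂ) :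
    x = ∑ i, (star (b i).ofLp ⬝ᵥ x) • (b i).ofLp := by
  have h := congrArg WithLp.ofLp (b.sum_repr' (WithLp.toLp 2 x))
  simp only [WithLp.ofLp_sum, WithLp.ofLp_smul] at h
  rw [← h]
  refine Finset.sum_congr rfl fun i _ => ?_
  rw [EuclideanSpace.inner_eq_star_dotProduct, dotProduct_comm, h]

theorem OrthonormalBasis.trace_mul_eq_sum_eigenvalues {N : ℕ}
    (b : OrthonormalBasis (Fin N) ℂ (EuclideanSpace ℂ (Fin N))) {A : Matrix (Fin N) (Fin N) ℂ}
    {a : Fin N → ℝ} (ha : ∀ i, A *ᵥ (b i).ofLp = (a i : ℂ) • (b i).ofLp)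
    (M : Matrix (Fin N) (Fin N) ℂ) :
    (M * A).trace.re = ∑ i, a i * (star (b i).ofLp ⬝ᵥ (M *ᵥ (b i).ofLp)).re := by
  rw [b.matrix_trace_eq_sum, Complex.re_sum]
  refine Finset.sum_congr rfl fun i _ => ?_
  rw [← Matrix.mulVec_mulVec, ha, Matrix.mulVec_smul, dotProduct_smul, smul_eq_mul,
    Complex.re_ofReal_mul]

/-- Replace `x` by its projection in the inner product and expand `0 ≤ ‖V.starProjection x - q‖ ^
2`. -/
theorem neg_norm_sq_starProjection_le {E : Type*} [NormedAddCommGroup E] [InnerProductSpace ℂ E]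
    (V : Submodule ℂ E) [V.HasOrthogonalProjection] (x : E) {q : E} (hq : q ∈ V) :
    -‖V.starProjection x‖ ^ 2 ≤ ‖q‖ ^ 2 - 2 * (inner ℂ x q).re := by
  have h1 : inner ℂ x q = inner ℂ (V.starProjection x) q := by
    rw [V.inner_starProjection_left_eq_right, Submodule.starProjection_eq_self_iff.mpr hq]
  have h2 := norm_sub_sq (𝕜 := ℂ) (V.starProjection x) q
  have h3 := sq_nonneg ‖V.starProjection x - q‖
  rw [h1]
  simp only [RCLike.re_to_complex] at h2
  linarith

/-- This is the trace of the projection: expand in an orthonormal basis of `V`, swap the sums and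
apply Parseval. -/
theorem OrthonormalBasis.sum_norm_sq_starProjection {ι E : Type*} [Fintype ι]
    [NormedAddCommGroup E] [InnerProductSpace ℂ E] [FiniteDimensional ℂ E]
    (b : OrthonormalBasis ι ℂ E) (V : Submodule ℂ E) :
    ∑ i, ‖V.starProjection (b i)‖ ^ 2 = Module.finrank ℂ V := by
  set c := stdOrthonormalBasis ℂ V
  have h : ∀ i, ‖V.starProjection (b i)‖ ^ 2 = ∑ j, ‖inner ℂ (b i) (c j : E)‖ ^ 2 := by
    intro i
    have h1 := c.sum_sq_norm_inner_left (V.orthogonalProjectionOnto (b i))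
    have h2 : ‖V.starProjection (b i)‖ = ‖V.orthogonalProjectionOnto (b i)‖ := rfl
    rw [h2, ← h1]
    refine Finset.sum_congr rfl fun j _ => ?_
    rw [Submodule.coe_inner]
    change ‖inner ℂ (V.starProjection (b i)) (c j : E)‖ ^ 2 = _
    rw [V.inner_starProjection_left_eq_right,
      Submodule.starProjection_eq_self_iff.mpr (c j).2]
  have hc : ∀ j, ‖(c j : E)‖ = 1 := fun j => c.norm_eq_one j
  simp_rw [h]
  rw [Finset.sum_comm]
  simp [b.sum_sq_norm_inner_right, hc]

/-- Bathtub principle: weights in `[0, 1]` of total at most `m` are best put on the first `m`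
terms of a nonincreasing nonnegative sequence. -/
theorem sum_mul_le_sum_of_antitone {N m : ℕ} {a p : Fin N → ℝ} (ha : Antitone a)
    (ha0 : ∀ i, 0 ≤ a i) (hp0 : ∀ i, 0 ≤ p i) (hp1 : ∀ i, p i ≤ 1) (hm : m ≤ N)
    (hp : ∑ i, p i ≤ m) :
    ∑ i, a i * p i ≤ ∑ i : Fin N, a i * (if (i : ℕ) < m then 1 else 0) := by
  -- A threshold separating the first `m` values from the rest. For `m = N` there is no next value,
  -- and 0 serves.
  obtain ⟨c, hc0, hc1, hc2⟩ : ∃ c : ℝ, 0 ≤ c ∧ (∀ i : Fin N, (i : ℕ) < m → c ≤ a i) ∧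
      ∀ i : Fin N, ¬ (i : ℕ) < m → a i ≤ c := by
    rcases hm.lt_or_eq with h | h
    · exact ⟨a ⟨m, h⟩, ha0 _, fun i hi => ha (Fin.mk_le_mk.mpr hi.le),
        fun i hi => ha (Fin.mk_le_mk.mpr (not_lt.mp hi))⟩
    · exact ⟨0, le_rfl, fun i _ => ha0 i, fun i hi => absurd (h ▸ i.2) hi⟩
  have hcard : ∑ i : Fin N, (if (i : ℕ) < m then (1 : ℝ) else 0) = m := by
    rw [Finset.sum_boole, Fin.card_filter_val_lt, min_eq_right hm]
  have hterm : ∀ i : Fin N, c * ((if (i : ℕ) < m then 1 else 0) - p i) ≤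
      a i * (if (i : ℕ) < m then 1 else 0) - a i * p i := by
    intro i
    have h0 := hp0 i
    have h1 := hp1 i
    split_ifs with hi
    · nlinarith [hc1 i hi]
    · nlinarith [hc2 i hi]
  have := Finset.sum_le_sum fun i (_ : i ∈ Finset.univ) => hterm i
  rw [← Finset.mul_sum, Finset.sum_sub_distrib, Finset.sum_sub_distrib, hcard] at this
  nlinarith

/-- In the eigenbasis each summand carries `‖Q b‖² - 2⟨b, Q b⟩` with `Q b` in the range of `Y`, so
it is bounded below by minus the squared projection of `b`. These weights total at most `m`. -/
theorem le_ommE_of_eigenbasis {N m : ℕ} (hm : m ≤ N) {A : Matrix (Fin N) (Fin N) ℂ}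
    (b : OrthonormalBasis (Fin N) ℂ (EuclideanSpace ℂ (Fin N)))
    {a : Fin N → ℝ} (ha : ∀ i, A *ᵥ (b i).ofLp = (a i : ℂ) • (b i).ofLp) (hmono : Antitone a)
    (ha0 : ∀ i, 0 ≤ a i) (Y : Matrix (Fin N) (Fin m) ℂ) :
    -∑ i : Fin N, a i * (if (i : ℕ) < m then 1 else 0) ≤ ommE (-A) Y := by
  set V : Submodule ℂ (EuclideanSpace ℂ (Fin N)) := LinearMap.range (Matrix.toEuclideanLin Y)
  have hfin : (Module.finrank ℂ V : ℝ) ≤ m := by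
    have := LinearMap.finrank_range_le (Matrix.toEuclideanLin Y)
    rw [finrank_euclideanSpace_fin] at this
    exact_mod_cast this
  have hle : ∑ i, a i * ‖V.starProjection (b i)‖ ^ 2 ≤
      ∑ i : Fin N, a i * (if (i : ℕ) < m then 1 else 0) := by
    refine sum_mul_le_sum_of_antitone hmono ha0 (fun i => by positivity) (fun i => ?_) hm
      (by rwa [b.sum_norm_sq_starProjection])
    have := V.norm_starProjection_apply_le (b i)
    rw [b.norm_eq_one] at this
    exact pow_le_one₀ (norm_nonneg _) this
  rw [ommE_neg_eq, b.trace_mul_eq_sum_eigenvalues ha]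
  refine (neg_le_neg hle).trans ?_
  rw [← Finset.sum_neg_distrib]
  refine Finset.sum_le_sum fun i _ => ?_
  rw [← mul_neg]
  refine mul_le_mul_of_nonneg_left ?_ (ha0 i)
  set Q := Y * Yᴴ with hQ
  have hQh : Qᴴ = Q := by simp [hQ]
  set q : EuclideanSpace ℂ (Fin N) := WithLp.toLp 2 (Q *ᵥ (b i).ofLp) with hq
  have hqV : q ∈ V := ⟨WithLp.toLp 2 (Yᴴ *ᵥ (b i).ofLp), by
    rw [Matrix.toLpLin_toLp, Matrix.toLin'_apply, Matrix.mulVec_mulVec]⟩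
  refine (neg_norm_sq_starProjection_le V (b i) hqV).trans_eq ?_
  have h1 : inner ℂ (b i) q = star (b i).ofLp ⬝ᵥ (Q *ᵥ (b i).ofLp) := by
    rw [EuclideanSpace.inner_eq_star_dotProduct, dotProduct_comm]
  have h2 : ‖q‖ ^ 2 = (star (b i).ofLp ⬝ᵥ ((Q * Q) *ᵥ (b i).ofLp)).re := by
    rw [← inner_self_eq_norm_sq (𝕜 := ℂ), EuclideanSpace.inner_eq_star_dotProduct, dotProduct_comm,
      hq]
    simp only [Matrix.star_mulVec, hQh, Matrix.dotProduct_mulVec, Matrix.vecMul_vecMul,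
      RCLike.re_to_complex]
  rw [h1, h2, Matrix.sub_mulVec, Matrix.smul_mulVec, dotProduct_sub, dotProduct_smul,
    Complex.sub_re, smul_eq_mul, ← Complex.ofReal_ofNat, Complex.re_ofReal_mul]

theorem ommE_le_of_lowLying {N m : ℕ} (hm : m ≤ N) {A : Matrix (Fin N) (Fin N) ℂ} (hA : A.PosDef)
    {X : Matrix (Fin N) (Fin m) ℂ} (hX : Xᴴ * X = 1)
    (hlow : IsLowLyingEigenspace (-A) m (Submodule.span ℂ (Set.range X.col)))
    (Y : Matrix (Fin N) (Fin m) ℂ) : ommE (-A) X ≤ ommE (-A) Y := by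
  obtain ⟨b, ev, hev, hb, hspan⟩ := hlow
  have ha : ∀ i, A *ᵥ (b i).ofLp = ((-ev i : ℝ) : ℂ) • (b i).ofLp := by
    intro i
    have := hb i
    rw [Matrix.neg_mulVec, neg_eq_iff_eq_neg] at this
    rw [this, Complex.ofReal_neg, neg_smul]
  have ha0 : ∀ i, 0 ≤ -ev i := by
    intro i
    have := (Complex.nonneg_iff.mp (hA.posSemidef.dotProduct_mulVec_nonneg (b i).ofLp)).1
    rw [ha, dotProduct_smul, b.star_dotProduct] at this
    simpa using this
  refine le_trans (le_of_eq ?_) (le_ommE_of_eigenbasis hm b ha (fun i j h => neg_le_neg (hev h)) ha0 Y)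
  set P := X * Xᴴ with hP
  have hPP : P * P = P := by
    rw [hP, Matrix.mul_assoc, ← Matrix.mul_assoc Xᴴ, hX, Matrix.one_mul]
  have hPb : ∀ i : Fin N, P *ᵥ (b i).ofLp = if (i : ℕ) < m then (b i).ofLp else 0 := by
    intro i
    split_ifs with hi
    · have hmem : (b i).ofLp ∈ LinearMap.range X.mulVecLin := by
        rw [Matrix.range_mulVecLin, hspan]
        exact Submodule.subset_span ⟨i, hi, rfl⟩
      obtain ⟨y, hy⟩ := hmem
      rw [← hy, Matrix.mulVecLin_apply, Matrix.mulVec_mulVec, hP, Matrix.mul_assoc, hX,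
        Matrix.mul_one]
    · have h0 : Xᴴ *ᵥ (b i).ofLp = 0 := by
        ext j
        have hall : ∀ y ∈ Submodule.span ℂ ((fun i => (b i).ofLp) '' {i : Fin N | (i : ℕ) < m}),
            star y ⬝ᵥ (b i).ofLp = 0 := by
          intro y hy
          induction hy using Submodule.span_induction with
          | mem y hy =>
            obtain ⟨k, hk, rfl⟩ := hy
            rw [b.star_dotProduct, if_neg]
            rintro rfl
            exact hi hk
          | zero => simp
          | add y z _ _ h1 h2 => rw [star_add, add_dotProduct, h1, h2, add_zero]
          | smul c y _ h1 => rw [star_smul, smul_dotProduct, h1, smul_zero]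
        exact hall (X.col j) (hspan ▸ Submodule.subset_span ⟨j, rfl⟩)
      rw [hP, ← Matrix.mulVec_mulVec, h0, Matrix.mulVec_zero]
  rw [ommE_neg_eq, b.trace_mul_eq_sum_eigenvalues ha, ← Finset.sum_neg_distrib, ← hP, hPP]
  refine Finset.sum_congr rfl fun i _ => ?_
  rw [← mul_neg]
  congr 1
  rw [Matrix.sub_mulVec, Matrix.smul_mulVec, hPb]
  split_ifs
  · rw [dotProduct_sub, dotProduct_smul, b.star_dotProduct]
    norm_num
  · simp

/-! ### Isometric local minima span low-lying eigenspaces -/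

/-- Since `P X = X`, the gradient equation reduces to `P A X = A X`: the range of `X` is invariant
under `A`, hence reducing because `A` is Hermitian. -/
theorem ommE_localMin_mulVec_comm {N m : ℕ} {A : Matrix (Fin N) (Fin N) ℂ} (hA : A.IsHermitian)
    {X : Matrix (Fin N) (Fin m) ℂ} (hX : IsLocalMin (ommE (-A)) X) (hS : Xᴴ * X = 1) :
    A * (X * Xᴴ) = X * Xᴴ * A := by
  have hg := ommE_localMin_gradient hA hX
  set P := X * Xᴴ with hP
  have hPh : Pᴴ = P := by simp [hP]
  have hPX : P * X = X := by rw [hP, Matrix.mul_assoc, hS, Matrix.mul_one]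
  have h1 : P * A * X = A * X := by
    rw [Matrix.add_mul, Matrix.mul_assoc A, Matrix.sub_mul, hPX, Matrix.one_mul, sub_self, Matrix.mul_zero,
      zero_add, sub_mul, Matrix.sub_mul, Matrix.one_mul, sub_eq_zero] at hg
    exact hg
  have h2 : P * A * P = A * P := by
    rw [hP, ← Matrix.mul_assoc (X * Xᴴ * A), ← hP, h1, Matrix.mul_assoc]
  have h3 := congrArg Matrix.conjTranspose h2
  simp only [Matrix.conjTranspose_mul, hPh, hA.eq, ← Matrix.mul_assoc] at h3
  rw [← h2, h3]

/-- Second-order condition: at an isometric local minimizer, eigenvalues of `A` on the range of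
`X` dominate those on its orthogonal complement. -/
theorem ommE_localMin_eigenvalue_le {N m : ℕ} {A : Matrix (Fin N) (Fin N) ℂ} (hA : A.IsHermitian)
    {X : Matrix (Fin N) (Fin m) ℂ} (hX : IsLocalMin (ommE (-A)) X)
    {v w : Fin N → ℂ} {α β : ℝ} (hw : (X * Xᴴ) *ᵥ w = w) (hv : (X * Xᴴ) *ᵥ v = 0)
    (hw0 : w ≠ 0) (hv0 : v ≠ 0) (hAw : A *ᵥ w = (α : ℂ) • w) (hAv : A *ᵥ v = (β : ℂ) • v) :
    β ≤ α := by
  set P := X * Xᴴ with hP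
  have hPh : Pᴴ = P := by simp [hP]
  have hwP : star w ᵥ* P = star w := by
    rw [← hPh, ← Matrix.star_mulVec, hw]
  have hvP : star v ᵥ* P = 0 := by
    rw [← hPh, ← Matrix.star_mulVec, hv, star_zero]
  have hwA : star w ᵥ* A = (α : ℂ) • star w := by
    rw [← hA.eq, ← Matrix.star_mulVec, hAw, star_smul, RCLike.star_def, Complex.conj_ofReal]
  have hvA : star v ᵥ* A = (β : ℂ) • star v := by
    rw [← hA.eq, ← Matrix.star_mulVec, hAv, star_smul, RCLike.star_def, Complex.conj_ofReal]
  have hwv : star w ⬝ᵥ v = 0 := by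
    rw [← hwP, ← Matrix.dotProduct_mulVec, hv, dotProduct_zero]
  have hvw : star v ⬝ᵥ w = 0 := by
    rw [← hw, Matrix.dotProduct_mulVec, hvP, zero_dotProduct]
  -- Tilt the range of `X` from `w` towards `v`; the second-order coefficient is `(α - β) ‖w‖²
  -- ‖v‖²`.
  set D := Matrix.vecMulVec v (star w) * X with hD
  have hDh : Dᴴ = Xᴴ * Matrix.vecMulVec w (star v) := by
    rw [hD, Matrix.conjTranspose_mul, Matrix.conjTranspose_vecMulVec, star_star]
  have hB : Matrix.vecMulVec w (star v) + Matrix.vecMulVec v (star w) = X * Dᴴ + D * Xᴴ := by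
    rw [hDh, hD, ← Matrix.mul_assoc, Matrix.mul_assoc _ X, ← hP, Matrix.mul_vecMulVec,
      Matrix.vecMulVec_mul, hw, hwP]
  have hC : (star w ⬝ᵥ w) • Matrix.vecMulVec v (star v) = D * Dᴴ := by
    rw [hDh, hD, Matrix.mul_assoc, ← Matrix.mul_assoc X, ← hP, Matrix.mul_vecMulVec, hw,
      Matrix.vecMulVec_mul_vecMulVec]
    ext i j
    simp [Matrix.vecMulVec_apply, mul_left_comm]
  obtain ⟨-, h⟩ := ommE_localMin_conditions hX D hP hB hC
  have hww : 0 < star w ⬝ᵥ w := Matrix.dotProduct_star_self_pos_iff.mpr hw0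
  have hvv : 0 < star v ⬝ᵥ v := Matrix.dotProduct_star_self_pos_iff.mpr hv0
  have key : (((Matrix.vecMulVec w (star v) + Matrix.vecMulVec v (star w)) *
      (Matrix.vecMulVec w (star v) + Matrix.vecMulVec v (star w)) +
      (P * ((star w ⬝ᵥ w) • Matrix.vecMulVec v (star v)) +
        (star w ⬝ᵥ w) • Matrix.vecMulVec v (star v) * P -
        (2 : ℂ) • ((star w ⬝ᵥ w) • Matrix.vecMulVec v (star v)))) * A).trace =
      ((α - β : ℝ) : ℂ) * ((star w ⬝ᵥ w) * (star v ⬝ᵥ v)) := by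
    simp only [Matrix.add_mul, Matrix.mul_add, Matrix.sub_mul, Matrix.smul_mul, Matrix.mul_smul,
      Matrix.vecMulVec_mul_vecMulVec]
    simp only [Matrix.mul_vecMulVec, Matrix.vecMulVec_mul, Matrix.smul_vecMul,
      hv, hvP, hwA, hvA, hwv, hvw, Matrix.trace_add, Matrix.trace_sub, Matrix.trace_smul,
      Matrix.trace_vecMulVec]
    simp [dotProduct_comm w, dotProduct_comm v]
    ring
  rw [key, Complex.re_ofReal_mul] at h
  have hpos := (Complex.pos_iff.mp (mul_pos hww hvv)).1
  nlinarith

theorem Matrix.IsHermitian.exists_sorted_eigenbasis {N : ℕ} {K : Matrix (Fin N) (Fin N) ℂ}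
    (hK : K.IsHermitian) :
    ∃ (b : OrthonormalBasis (Fin N) ℂ (EuclideanSpace ℂ (Fin N))) (k : Fin N → ℝ), Monotone k ∧
      ∀ i, K *ᵥ (b i).ofLp = (k i : ℂ) • (b i).ofLp := by
  refine ⟨hK.eigenvectorBasis.reindex (Tuple.sort hK.eigenvalues).symm,
    hK.eigenvalues ∘ Tuple.sort hK.eigenvalues, Tuple.monotone_sort _, fun i => ?_⟩
  rw [OrthonormalBasis.reindex_apply, Equiv.symm_symm]
  exact hK.mulVec_eigenvectorBasis _

/-- A set of `m` elements of `Fin N` that is closed downwards consists of the first `m`. -/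
theorem Fin.mem_iff_val_lt_of_isLowerSet {N m : ℕ} {s : Finset (Fin N)} (hs : IsLowerSet (s : Set (Fin N)))
    (hcard : s.card = m) (i : Fin N) : i ∈ s ↔ (i : ℕ) < m := by
  constructor
  · intro hi
    have : Finset.Iic i ⊆ s := fun j hj => hs (Finset.mem_Iic.mp hj) hi
    have := Finset.card_le_card this
    rw [Fin.card_Iic, hcard] at this
    omega
  · intro hi
    by_contra hni
    have : s ⊆ Finset.Iio i := fun j hj =>
      Finset.mem_Iio.mpr (lt_of_not_ge fun h => hni (hs h hj))
    have := Finset.card_le_card this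
    rw [Fin.card_Iio, hcard] at this
    omega

theorem isLowLyingEigenspace_of_localMin {N m : ℕ} {A : Matrix (Fin N) (Fin N) ℂ}
    (hA : A.IsHermitian) {X : Matrix (Fin N) (Fin m) ℂ} (hX : IsLocalMin (ommE (-A)) X)
    (hS : Xᴴ * X = 1) :
    IsLowLyingEigenspace (-A) m (Submodule.span ℂ (Set.range X.col)) := by
  classical
  have hcomm := ommE_localMin_mulVec_comm hA hX hS
  have hord := fun v w α β => ommE_localMin_eigenvalue_le hA hX (v := v) (w := w) (α := α) (β := β)
  set P := X * Xᴴ with hP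
  have hPh : Pᴴ = P := by simp [hP]
  have hPX : P * X = X := by rw [hP, Matrix.mul_assoc, hS, Matrix.mul_one]
  have hPP : P * P = P := by
    rw [hP, ← Matrix.mul_assoc (X * Xᴴ), ← hP, hPX]
  -- Subtracting `P` separates the spectrum on the range of `X` from that on its complement.
  have hK : (-A - P).IsHermitian := hA.neg.sub hPh
  obtain ⟨b, k, hk, hb⟩ := hK.exists_sorted_eigenbasis
  have hA' : ∀ i, A *ᵥ (b i).ofLp = -((k i : ℂ) • (b i).ofLp) - P *ᵥ (b i).ofLp := by
    intro i
    have := hb i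
    rw [Matrix.sub_mulVec, Matrix.neg_mulVec] at this
    rw [← this]
    abel
  have hAP : ∀ i, A *ᵥ (P *ᵥ (b i).ofLp) = ((-k i - 1 : ℝ) : ℂ) • (P *ᵥ (b i).ofLp) := by
    intro i
    rw [Matrix.mulVec_mulVec, hcomm, ← Matrix.mulVec_mulVec, hA', Matrix.mulVec_sub,
      Matrix.mulVec_neg, Matrix.mulVec_smul, Matrix.mulVec_mulVec, hPP]
    push_cast
    module
  have hAQ : ∀ i, A *ᵥ ((b i).ofLp - P *ᵥ (b i).ofLp) =
      ((-k i : ℝ) : ℂ) • ((b i).ofLp - P *ᵥ (b i).ofLp) := by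
    intro i
    rw [Matrix.mulVec_sub, hAP, hA']
    push_cast
    module
  have hPPb : ∀ i, P *ᵥ (P *ᵥ (b i).ofLp) = P *ᵥ (b i).ofLp := by
    intro i
    rw [Matrix.mulVec_mulVec, hPP]
  have hPQ : ∀ i, P *ᵥ ((b i).ofLp - P *ᵥ (b i).ofLp) = 0 := by
    intro i
    rw [Matrix.mulVec_sub, hPPb, sub_self]
  have hgap : ∀ i j, P *ᵥ (b i).ofLp ≠ 0 → P *ᵥ (b j).ofLp ≠ (b j).ofLp → k i + 1 ≤ k j := by
    intro i j hi hj
    have := hord _ _ _ _ (hPPb i) (hPQ j) hi (sub_ne_zero.mpr hj.symm) (hAP i) (hAQ j)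
    linarith
  have hdich : ∀ i, P *ᵥ (b i).ofLp ≠ (b i).ofLp → P *ᵥ (b i).ofLp = 0 := by
    intro i hi
    -- Otherwise `hgap i i` reads `k i + 1 ≤ k i`: no basis vector straddles the range and its
    -- complement.
    by_contra h0
    linarith [hgap i i h0 hi]
  have hb0 : ∀ i, (b i).ofLp ≠ 0 := by
    intro i h0
    have := b.star_dotProduct i i
    simp [h0] at this
  set s : Finset (Fin N) := Finset.univ.filter fun i => P *ᵥ (b i).ofLp = (b i).ofLp with hs
  have hmem : ∀ i, i ∈ s ↔ P *ᵥ (b i).ofLp = (b i).ofLp := by simp [hs]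
  have hcard : s.card = m := by
    have h1 : P.trace = m := by
      rw [hP, Matrix.trace_mul_comm, hS, Matrix.trace_one, Fintype.card_fin]
    have h2 : P.trace = s.card := by
      rw [b.matrix_trace_eq_sum, hs, ← Finset.sum_boole]
      refine Finset.sum_congr rfl fun i _ => ?_
      split_ifs with hi
      · rw [hi, b.star_dotProduct, if_pos rfl]
      · rw [hdich i hi, dotProduct_zero]
    exact_mod_cast h2.symm.trans h1
  have hlower : IsLowerSet (s : Set (Fin N)) := by
    intro j i hij hj
    rw [Finset.mem_coe, hmem] at hj ⊢
    by_contra hi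
    linarith [hgap j i (by rw [hj]; exact hb0 j) hi, hk hij]
  have hlt : ∀ i : Fin N, P *ᵥ (b i).ofLp = (b i).ofLp ↔ (i : ℕ) < m := fun i => by
    rw [← hmem, Fin.mem_iff_val_lt_of_isLowerSet hlower hcard]
  -- Adding `P` back raises the eigenvalue by 1 on the range; `hgap` keeps the order.
  refine ⟨b, fun i => if (i : ℕ) < m then k i + 1 else k i, ?_, ?_, ?_⟩
  · intro i j hij
    have hkij := hk hij
    have hv : (i : ℕ) ≤ j := hij
    dsimp only
    split_ifs with h1 h2 h2
    · linarith
    · exact hgap i j (by rw [(hlt i).mpr h1]; exact hb0 i) (fun h => h2 ((hlt j).mp h))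
    · omega
    · exact hkij
  · intro i
    dsimp only
    rw [Matrix.neg_mulVec, hA']
    split_ifs with h
    · rw [(hlt i).mpr h]
      push_cast
      module
    · rw [hdich i fun h' => h ((hlt i).mp h')]
      module
  · apply le_antisymm
    · rw [Submodule.span_le]
      rintro _ ⟨j, rfl⟩
      have hPc : P *ᵥ X.col j = X.col j := by
        ext i
        exact congrFun (congrFun hPX i) j
      rw [← hPc, b.eq_sum_star_dotProduct_smul (X.col j), Matrix.mulVec_sum]
      refine Submodule.sum_mem _ fun i _ => ?_
      rw [Matrix.mulVec_smul]
      refine Submodule.smul_mem _ _ ?_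
      by_cases hi : (i : ℕ) < m
      · rw [(hlt i).mpr hi]
        exact Submodule.subset_span ⟨i, hi, rfl⟩
      · rw [hdich i fun h' => hi ((hlt i).mp h')]
        exact Submodule.zero_mem _
    · rw [Submodule.span_le]
      rintro _ ⟨i, hi, rfl⟩
      rw [← Matrix.range_mulVecLin]
      refine ⟨Xᴴ *ᵥ (b i).ofLp, ?_⟩
      rw [Matrix.mulVecLin_apply, Matrix.mulVec_mulVec]
      exact (hlt i).mpr hi

/-! ### The two full-rank cases and the conclusion -/

theorem Matrix.eq_zero_of_mul_eq_zero_of_mulVec_injective {N m p : ℕ}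
    {X : Matrix (Fin N) (Fin m) ℂ} (hX : ∀ u, X *ᵥ u = 0 → u = 0) {Z : Matrix (Fin m) (Fin p) ℂ}
    (h : X * Z = 0) : Z = 0 := by
  ext i j
  have : Z.col j = 0 := hX _ (by ext l; exact congrFun (congrFun h l) j)
  exact congrFun this i

theorem ommE_localMin_dichotomy {N m : ℕ} {A : Matrix (Fin N) (Fin N) ℂ} (hA : A.PosDef)
    {X : Matrix (Fin N) (Fin m) ℂ} (hX : IsLocalMin (ommE (-A)) X) :
    (m ≤ N ∧ Xᴴ * X = 1) ∨ (N ≤ m ∧ X * Xᴴ = 1) := by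
  have hpi := ommE_localMin_partialIsometry hA hX
  by_cases hinj : ∀ u, X *ᵥ u = 0 → u = 0
  · left
    refine ⟨?_, sub_eq_zero.mp (Matrix.eq_zero_of_mul_eq_zero_of_mulVec_injective hinj hpi)⟩
    have : Function.Injective X.mulVecLin := (injective_iff_map_eq_zero _).mpr hinj
    simpa using LinearMap.finrank_le_finrank_of_injective this
  · right
    push Not at hinj
    obtain ⟨u, hu, hu0⟩ := hinj
    have hinj' : ∀ v, Xᴴ *ᵥ v = 0 → v = 0 := fun v hv =>
      (ommE_localMin_fullRank hA hX hu hv).resolve_left hu0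
    constructor
    · have : Function.Injective Xᴴ.mulVecLin := (injective_iff_map_eq_zero _).mpr hinj'
      simpa using LinearMap.finrank_le_finrank_of_injective this
    · refine sub_eq_zero.mp (Matrix.eq_zero_of_mul_eq_zero_of_mulVec_injective hinj' ?_)
      have := congrArg Matrix.conjTranspose hpi
      simp only [Matrix.conjTranspose_mul, Matrix.conjTranspose_sub, Matrix.conjTranspose_one,
        Matrix.conjTranspose_conjTranspose, Matrix.conjTranspose_zero] at this
      rw [← this, Matrix.mul_sub, Matrix.sub_mul, Matrix.mul_one, Matrix.one_mul, Matrix.mul_assoc]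

/-- Completing the square, the functional at `Y` is `tr(Qᴴ A Q) - tr A` with `Q = Y * Yᴴ - 1`, and
`Q` vanishes at `X`. -/
theorem ommE_le_of_mul_conjTranspose_eq_one {N m : ℕ} {A : Matrix (Fin N) (Fin N) ℂ}
    (hA : A.PosDef) {X : Matrix (Fin N) (Fin m) ℂ} (hX : X * Xᴴ = 1)
    (Y : Matrix (Fin N) (Fin m) ℂ) : ommE (-A) X ≤ ommE (-A) Y := by
  set Q := Y * Yᴴ - 1 with hQ
  have hQh : Qᴴ = Q := by simp [hQ]
  have hpos := (Complex.nonneg_iff.mp (hA.posSemidef.conjTranspose_mul_mul_same Q).trace_nonneg).1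
  have e : (Qᴴ * A * Q).trace = (Q * Q * A).trace := by
    rw [hQh, Matrix.trace_mul_comm, Matrix.mul_assoc]
  have e2 : Y * Yᴴ * (Y * Yᴴ) - (2 : ℂ) • (Y * Yᴴ) = Q * Q - 1 := by
    rw [hQ, sub_mul, mul_sub, Matrix.mul_one, Matrix.one_mul, two_smul]
    abel
  rw [ommE_neg_eq, ommE_neg_eq, hX, e2, sub_mul (Q * Q), Matrix.trace_sub, Complex.sub_re, ← e]
  have e3 : (1 : Matrix (Fin N) (Fin N) ℂ) * 1 - (2 : ℂ) • 1 = -1 := by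
    rw [Matrix.mul_one, two_smul]; abel
  rw [e3, Matrix.neg_mul, Matrix.trace_neg, Complex.neg_re]
  linarith

theorem theorem2p2 (N m : ℕ) (H : Matrix (Fin N) (Fin N) ℂ)
    (hH : H.IsHermitian) (hneg : (-H).PosDef) :
    (∀ X : Matrix (Fin N) (Fin m) ℂ,
      IsLocalMin (ommE H) X → ∀ Y : Matrix (Fin N) (Fin m) ℂ, ommE H X ≤ ommE H Y) ∧
    (m ≤ N → ∀ X : Matrix (Fin N) (Fin m) ℂ,
      (∀ Y : Matrix (Fin N) (Fin m) ℂ, ommE H X ≤ ommE H Y) ↔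
        (Xᴴ * X = 1 ∧ IsLowLyingEigenspace H m (Submodule.span ℂ (Set.range X.col)))) := by
  obtain ⟨A, rfl⟩ : ∃ A, H = -A := ⟨-H, (neg_neg H).symm⟩
  rw [neg_neg] at hneg
  refine ⟨fun X hX => ?_, fun hm X => ⟨fun hX => ?_, fun h => ommE_le_of_lowLying hm hneg h.1 h.2⟩⟩
  · rcases ommE_localMin_dichotomy hneg hX with ⟨hm, h⟩ | ⟨-, h⟩
    · exact ommE_le_of_lowLying hm hneg h (isLowLyingEigenspace_of_localMin hneg.isHermitian hX h)
    · exact ommE_le_of_mul_conjTranspose_eq_one hneg h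
  · have hloc : IsLocalMin (ommE (-A)) X := Eventually.of_forall hX
    have hS : Xᴴ * X = 1 := by
      rcases ommE_localMin_dichotomy hneg hloc with ⟨-, h⟩ | ⟨hm', h⟩
      · exact h
      -- Here `X` is square, so its one-sided inverse is two-sided.
      · obtain rfl := le_antisymm hm hm'
        exact mul_eq_one_comm.mp h
    exact ⟨hS, isLowLyingEigenspace_of_localMin hneg.isHermitian hloc hS⟩
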